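/- Let $L$ be a finite set, let $I\subseteq L\times L$ be an irreflexive symmetric relation (independence) with complement $D=(L\times L)\setminus I$ (dependence), and let $(G_\alpha)_{\alpha\in L}$ be finitely generated non-trivial groups. Let $G$ be the graph product, i.e. the quotient of the free product $\ast_{\alpha\in L}G_\alpha$ by the relations $gh=hg$ for all $g\in G_\alpha$, $h\in G_\beta$ with $(\alpha,\beta)\in I$. Let $\Gamma$ be the disjoint union of the sets $\Gamma_\alpha=G_\alpha\setminus\{1\}$; a word over $\Gamma$ denotes the product of its letters in $G$. The dependence graph $D(w)$ of a word $w=a_1\cdots a_n\in\Gamma^*$, $a_i\in\Gamma_{\alpha_i}$, is the directed graph with vertices $1,\dots,n$, where $i$ is labeled by $a_i$, and with arcs $(i,j)$ for all $i<j$ with $(\alpha_i,\alpha_j)\in D$. Write $u\equiv v$ if $D(u)$ and $D(v)$ are isomorphic as node-labeled directed graphs. The Hasse diagram of $D(w)$ is obtained by removing each arc $(i,k)$ for which there is a vertex $j$ with arcs $(i,j)$ and $(j,k)$. The word $w$ is reduced if no arc $(i,j)$ of the Hasse diagram has $\alpha_i=\alpha_j$, and cyclically reduced if, moreover, there are no minimal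 vertex $i$ (no incoming arc) and maximal vertex $j$ (no outgoing arc) of $D(w)$ with $i\ne j$ and $\alpha_i=\alpha_j$. The alphabet of $w$ is $\mathrm{alph}(w)=\{\alpha_1,\dots,\alpha_n\}\subseteq L$, and $w$ is connected if $\mathrm{alph}(w)$ induces a connected subgraph of $(L,D)$. Words $u,v\in\Gamma^*$ are transposed if there are $r,s\in\Gamma^*$ with $u\equiv rs$ and $v\equiv sr$; let $\approx$ be the transitive closure of this relation. Proposition. Let $x,y\in\Gamma^*$ be cyclically reduced and connected words such that $\mathrm{alph}(x)=\mathrm{alph}(y)$ and $|\mathrm{alph}(x)|\ge 2$. Then $x$ and $y$ are conjugate in $G$ if and only if $x\approx y$. -/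

import Mathlib

namespace GraphProd

universe u v

variable {L : Type u}

/-- The defining relators of a graph product inside the free product of the node groups:
the commutators of `g : G α` and `h : G β` for independent nodes `α`, `β`.
The irreflexive symmetric independence relation is the adjacency relation of `I`. -/
def relators (I : SimpleGraph L) (G : L → Type v) [∀ α, Group (G α)] :
    Set (Monoid.CoprodI G) :=
  {w | ∃ (α β : L) (g : G α) (h : G β), I.Adj α β ∧
    w = Monoid.CoprodI.of g * Monoid.CoprodI.of h *
      (Monoid.CoprodI.of g)⁻¹ * (Monoid.CoprodI.of h)⁻¹}

/-- The graph product of the groups `G α`: the quotient of the free product by the relations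
`g h = h g` for `g : G α`, `h : G β` with `α`, `β` independent. -/
abbrev GraphProduct (I : SimpleGraph L) (G : L → Type v) [∀ α, Group (G α)] : Type (max u v) :=
  Monoid.CoprodI G ⧸ Subgroup.normalClosure (relators I G)

/-- The alphabet `Γ`: the disjoint union of the sets `Γ_α = G α \ {1}`. -/
structure Letter (G : L → Type v) [∀ α, Group (G α)] where
  /-- The node `α` with the letter in `Γ_α`. -/
  node : L
  /-- The underlying group element. -/
  val : G node
  /-- Letters are nontrivial. -/
  ne_one : val ≠ 1

/-- Words over `Γ`. -/
abbrev Word (G : L → Type v) [∀ α, Group (G α)] : Type (max u v) := List (Letter G)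

variable {G : L → Type v} [∀ α, Group (G α)]

/-- The element of the graph product that is denoted by a word over `Γ`. -/
def Word.toGroup (I : SimpleGraph L) (w : Word G) : GraphProduct I G :=
  (w.map fun a => ((Monoid.CoprodI.of a.val : Monoid.CoprodI G) : GraphProduct I G)).prod

/-- The arcs of the dependence graph `D(w)`. Its vertices are the positions of `w`, labelled by
the letters of `w`; the dependence relation on nodes is the complement of the independence
relation, so every node depends on itself. -/
def Arc (I : SimpleGraph L) (w : Word G) (i j : Fin w.length) : Prop :=
  i < j ∧ ¬ I.Adj (w.get i).node (w.get j).node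

/-- `u ≡ v`: the dependence graphs of `u` and `v` are isomorphic as node-labelled directed
graphs. -/
def DepIso (I : SimpleGraph L) (u v : Word G) : Prop :=
  ∃ σ : Fin u.length ≃ Fin v.length,
    (∀ i, v.get (σ i) = u.get i) ∧ ∀ i j, Arc I u i j ↔ Arc I v (σ i) (σ j)

/-- The arcs of the Hasse diagram of the dependence graph: arcs `(i, k)` for which there is no `j`
with arcs `(i, j)` and `(j, k)`. -/
def HasseArc (I : SimpleGraph L) (w : Word G) (i k : Fin w.length) : Prop :=
  Arc I w i k ∧ ¬ ∃ j, Arc I w i j ∧ Arc I w j k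

/-- A word is reduced if neighbours in the Hasse diagram of its dependence graph have labels from
different nodes. -/
def IsReduced (I : SimpleGraph L) (w : Word G) : Prop :=
  ∀ i j, HasseArc I w i j → (w.get i).node ≠ (w.get j).node

/-- Minimal vertices of the dependence graph. -/
def IsMinVertex (I : SimpleGraph L) (w : Word G) (i : Fin w.length) : Prop :=
  ∀ j, ¬ Arc I w j i

/-- Maximal vertices of the dependence graph. -/
def IsMaxVertex (I : SimpleGraph L) (w : Word G) (i : Fin w.length) : Prop :=
  ∀ j, ¬ Arc I w i j

/-- A reduced word is cyclically reduced if there are no minimal vertex `i` and maximal vertex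
`j ≠ i` of the dependence graph with labels from the same node. -/
def IsCyclicallyReduced (I : SimpleGraph L) (w : Word G) : Prop :=
  IsReduced I w ∧
    ∀ i j, IsMinVertex I w i → IsMaxVertex I w j → i ≠ j → (w.get i).node ≠ (w.get j).node

/-- The alphabet of a word: the set of nodes `α` such that some letter of `w` is in `Γ_α`. -/
def al (w : Word G) : Set L :=
  {α | ∃ a ∈ w, a.node = α}

/-- A word is connected if its alphabet induces a connected subgraph of the graph `(L, D)` of
the dependence relation (loops are irrelevant for this). -/
def IsConnected (I : SimpleGraph L) (w : Word G) : Prop :=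
  (Iᶜ.induce (al w)).Connected

/-- The words `u` and `v` are transposed: `u ≡ rs` and `v ≡ sr` for some words `r`, `s`. -/
def Transposed (I : SimpleGraph L) (u v : Word G) : Prop :=
  ∃ r s : Word G, DepIso I u (r ++ s) ∧ DepIso I v (s ++ r)

/-- The relation `≈`: the transitive closure of transposition. -/
def TranspositionEquiv (I : SimpleGraph L) : Word G → Word G → Prop :=
  Relation.TransGen (Transposed I)

end GraphProd

/-! Two facts carry the proof: a normal form theorem and a descent on the length of a conjugator.

Isomorphism of dependence graphs is the same as trace equivalence, that is, swapping adjacent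
independent letters (`TraceEq.depIso`, `DepIso.traceEq`). Nodes depend on themselves, so a trace has
at most one first letter from each node, its `head`. Multiplying that head by an element of the node
group makes the graph product act on reduced traces. Applied to the empty trace, a reduced word
returns its own trace, so reduced words with equal values are trace equivalent
(`traceEq_of_toGroup_eq`).

Let `w y = x w` in the group with `w` reduced. If `w` and `x` begin with the same letter, that
letter can be rotated to the end of `x`, which is a transposition, and cancelled from `w`. The same
works for the pairs obtained by inverting `x, y` and by exchanging them while inverting `w`. If no
such step exists, then none of `x w`, `x⁻¹ w`, `w y`, `w y⁻¹` has a cancellation; letters may merge,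
but none disappears. By `head_redMul` a first letter `a` of `w` then survives in `w y = x w`, so
either `x` begins at the node of `a` or `a` commutes with all of `x`; likewise for `x⁻¹`. A
cyclically reduced `x` cannot begin and end at one node, so `a` commutes with `x` and can be dropped
from `w`. This is the induction in `transpositionEquiv_of_conj`.

Connectedness and an alphabet of size at least two exclude a node whose only letter is isolated,
hence both first and last; this turns the given condition into the stronger `CycRed`. -/

namespace GraphProd

universe u v

variable {L : Type u} {G : L → Type v} [∀ α, Group (G α)] (I : SimpleGraph L)

/-! ### Trace equivalence -/

/-- Trace equivalence: words that differ by swaps of adjacent independent letters. -/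
inductive TraceEq : Word G → Word G → Prop
  | nil : TraceEq [] []
  | cons (a : Letter G) {u v : Word G} : TraceEq u v → TraceEq (a :: u) (a :: v)
  | swap (a b : Letter G) (u : Word G) : I.Adj a.node b.node →
      TraceEq (a :: b :: u) (b :: a :: u)
  | trans {u v w : Word G} : TraceEq u v → TraceEq v w → TraceEq u w

namespace TraceEq

variable {I}

theorem refl : ∀ u : Word G, TraceEq I u u
  | [] => nil
  | a :: u => cons a (refl u)

theorem symm {u v : Word G} (h : TraceEq I u v) : TraceEq I v u := by
  induction h with
  | nil => exact nil
  | cons a _ ih => exact cons a ih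
  | swap a b u h => exact swap b a u h.symm
  | trans _ _ ih₁ ih₂ => exact ih₂.trans ih₁

theorem perm {u v : Word G} (h : TraceEq I u v) : u.Perm v := by
  induction h with
  | nil => exact .nil
  | cons a _ ih => exact .cons a ih
  | swap a b u h => exact .swap b a u
  | trans _ _ ih₁ ih₂ => exact ih₁.trans ih₂

theorem append_left (w : Word G) {u v : Word G} (h : TraceEq I u v) :
    TraceEq I (w ++ u) (w ++ v) := by
  induction w with
  | nil => exact h
  | cons a w ih => exact cons a ih

theorem append_right (w : Word G) {u v : Word G} (h : TraceEq I u v) :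
    TraceEq I (u ++ w) (v ++ w) := by
  induction h with
  | nil => exact refl w
  | cons a _ ih => exact cons a ih
  | swap a b u h => exact swap a b _ h
  | trans _ _ ih₁ ih₂ => exact ih₁.trans ih₂

end TraceEq

/-! ### Trace equivalence and isomorphism of dependence graphs -/

theorem DepIso.refl (u : Word G) : DepIso I u u :=
  ⟨Equiv.refl _, fun _ => rfl, fun _ _ => Iff.rfl⟩

variable {I}

theorem DepIso.trans {u v w : Word G} (h₁ : DepIso I u v) (h₂ : DepIso I v w) :
    DepIso I u w := by
  obtain ⟨σ, hσ, hσ'⟩ := h₁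
  obtain ⟨τ, hτ, hτ'⟩ := h₂
  exact ⟨σ.trans τ, fun i => (hτ _).trans (hσ i), fun i j => (hσ' i j).trans (hτ' _ _)⟩

/-- A label-preserving bijection that is monotone on dependent pairs is an isomorphism of
dependence graphs. -/
theorem DepIso.of_monotone {u v : Word G} (σ : Fin u.length ≃ Fin v.length)
    (hget : ∀ i, v.get (σ i) = u.get i)
    (hmono : ∀ i j, i < j → ¬ I.Adj (u.get i).node (u.get j).node → σ i < σ j) :
    DepIso I u v := by
  refine ⟨σ, hget, fun i j => ⟨fun h => ⟨hmono i j h.1 h.2, ?_⟩, fun h => ?_⟩⟩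
  · rw [hget, hget]; exact h.2
  · have h2 := h.2
    rw [hget, hget] at h2
    refine ⟨?_, h2⟩
    rcases lt_trichotomy i j with hij | hij | hij
    · exact hij
    · exact absurd h.1 (by simp [hij])
    · exact absurd h.1 (hmono j i hij fun h' => h2 h'.symm).asymm

theorem DepIso.cons (a : Letter G) {u v : Word G} (h : DepIso I u v) :
    DepIso I (a :: u) (a :: v) := by
  obtain ⟨σ, hσ, hσ'⟩ := h
  let τ : Fin (u.length + 1) ≃ Fin (v.length + 1) :=
    -- The extension of `σ` by `0 ↦ 0`.
    (finSuccEquiv u.length).trans ((Equiv.optionCongr σ).trans (finSuccEquiv v.length).symm)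
  have τ0 : τ 0 = 0 := by simp [τ]
  have τs : ∀ i : Fin u.length, τ i.succ = (σ i).succ := fun i => by simp [τ]
  refine DepIso.of_monotone τ (fun i => ?_) (fun i j hij hadj => ?_)
  · induction i using Fin.cases with
    | zero => rw [τ0]; rfl
    | succ i => rw [τs]; exact hσ i
  · induction j using Fin.cases with
    | zero => exact absurd hij (Fin.not_lt_zero _)
    | succ j =>
      induction i using Fin.cases with
      | zero => rw [τ0, τs]; exact Fin.succ_pos _
      | succ i =>
        rw [τs, τs]
        exact Fin.succ_lt_succ_iff.2 ((hσ' i j).1 ⟨Fin.succ_lt_succ_iff.1 hij, hadj⟩).1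

theorem DepIso.swap (a b : Letter G) (u : Word G) (h : I.Adj a.node b.node) :
    DepIso I (a :: b :: u) (b :: a :: u) := by
  let τ : Fin (u.length + 2) ≃ Fin (u.length + 2) := Equiv.swap 0 1
  have τ0 : τ 0 = 1 := Equiv.swap_apply_left _ _
  have τ1 : τ (Fin.succ 0) = 0 := Equiv.swap_apply_right _ _
  have τs : ∀ i : Fin u.length, τ i.succ.succ = i.succ.succ := fun i =>
    Equiv.swap_apply_of_ne_of_ne (Fin.succ_ne_zero _)
      fun h => Fin.succ_ne_zero i (Fin.succ_injective _ h)
  refine DepIso.of_monotone τ (fun i => ?_) (fun i j hij hadj => ?_)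
  · induction i using Fin.cases with
    | zero => rw [τ0]; rfl
    | succ i =>
      induction i using Fin.cases with
      | zero => rw [τ1]; rfl
      | succ i => rw [τs]; rfl
  · induction j using Fin.cases with
    | zero => exact absurd hij (Fin.not_lt_zero _)
    | succ j =>
      induction j using Fin.cases with
      | zero =>
        induction i using Fin.cases with
        | zero => exact absurd h hadj
        | succ i => exact absurd (Fin.succ_lt_succ_iff.1 hij) (Fin.not_lt_zero _)
      | succ j =>
        rw [τs]
        induction i using Fin.cases with
        | zero => rw [τ0]; exact Fin.succ_lt_succ_iff.2 (Fin.succ_pos _)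
        | succ i =>
          induction i using Fin.cases with
          | zero => rw [τ1]; exact Fin.succ_pos _
          | succ i => rw [τs]; exact hij

theorem TraceEq.depIso {u v : Word G} (h : TraceEq I u v) : DepIso I u v := by
  induction h with
  | nil => exact DepIso.refl I []
  | cons a _ ih => exact ih.cons a
  | swap a b u h => exact DepIso.swap a b u h
  | trans _ _ ih₁ ih₂ => exact ih₁.trans ih₂

/-- A letter that is independent of all its predecessors can be moved to the front. -/
theorem TraceEq.ofFn_move_front : ∀ {n : ℕ} (g : Fin (n + 1) → Letter G) (k : Fin (n + 1)),
    (∀ m < k, I.Adj (g m).node (g k).node) →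
    TraceEq I (List.ofFn g) (g k :: List.ofFn fun i => g (k.succAbove i))
  | 0, g, k, _ => by
    have : k = 0 := Fin.fin_one_eq_zero k
    subst this
    simpa using TraceEq.refl _
  | n + 1, g, k, hk => by
    induction k using Fin.cases with
    | zero => simpa [List.ofFn_succ] using TraceEq.refl _
    | succ k =>
      have ih := TraceEq.ofFn_move_front (fun i => g i.succ) k
        fun m hm => hk m.succ (Fin.succ_lt_succ_iff.2 hm)
      rw [List.ofFn_succ]
      refine (TraceEq.cons (g 0) ih).trans ?_
      rw [List.ofFn_succ (f := fun i => g (k.succ.succAbove i))]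
      simp only [Fin.succ_succAbove_zero, Fin.succ_succAbove_succ]
      exact TraceEq.swap _ _ _ (hk 0 (Fin.succ_pos _))

/-- The first letter of `f` sits at position `σ 0` of `g`. A dependent letter before it would be the
image of a later index, against monotonicity; so it moves to the front of `g`, and induction applies
to the remaining letters. -/
theorem TraceEq.ofFn_of_injective : ∀ {n : ℕ} (f g : Fin n → Letter G) (σ : Fin n → Fin n),
    Function.Injective σ → (∀ i, g (σ i) = f i) →
    (∀ i j, i < j → ¬ I.Adj (f i).node (f j).node → σ i < σ j) →
    TraceEq I (List.ofFn f) (List.ofFn g)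
  | 0, f, g, _, _, _, _ => by simpa using TraceEq.refl _
  | n + 1, f, g, σ, hσ, hget, hmono => by
    have hsurj := Finite.injective_iff_surjective.1 hσ
    have hmove := TraceEq.ofFn_move_front (I := I) g (σ 0) (by
      intro m hm
      obtain ⟨i, rfl⟩ := hsurj m
      by_contra hadj
      have hi : i ≠ 0 := by rintro rfl; exact lt_irrefl _ hm
      refine hm.asymm (hmono 0 i (Fin.pos_iff_ne_zero.2 hi) ?_)
      rw [← hget, ← hget]
      exact fun h => hadj h.symm)
    -- Deleting position `σ 0` from the target turns `σ` on the nonzero indices into a self-map `τ`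
    -- of `Fin n`.
    have hex : ∀ i : Fin n, ∃ j, (σ 0).succAbove j = σ i.succ := fun i =>
      Fin.exists_succAbove_eq fun h => Fin.succ_ne_zero i (hσ h)
    choose τ hτ using hex
    refine TraceEq.trans ?_ hmove.symm
    rw [List.ofFn_succ, hget]
    refine TraceEq.cons _ (TraceEq.ofFn_of_injective _ _ τ ?_ ?_ ?_)
    · intro i j hij
      have := congrArg (σ 0).succAbove hij
      rw [hτ, hτ] at this
      exact Fin.succ_injective _ (hσ this)
    · intro i
      rw [hτ, hget]
    · intro i j hij hadj
      rw [← Fin.succAbove_lt_succAbove_iff (p := σ 0), hτ, hτ]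
      exact hmono _ _ (Fin.succ_lt_succ_iff.2 hij) hadj

theorem DepIso.traceEq {u v : Word G} (h : DepIso I u v) : TraceEq I u v := by
  obtain ⟨σ, hσ, hσ'⟩ := h
  have key : ∀ {n m : ℕ} (f : Fin n → Letter G) (g : Fin m → Letter G) (σ : Fin n ≃ Fin m),
      (∀ i, g (σ i) = f i) → (∀ i j, i < j → ¬ I.Adj (f i).node (f j).node → σ i < σ j) →
      TraceEq I (List.ofFn f) (List.ofFn g) := by
    intro n m f g σ h₁ h₂
    obtain rfl : n = m := by simpa using Fintype.card_congr σ
    exact TraceEq.ofFn_of_injective f g σ σ.injective h₁ h₂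
  have := key u.get v.get σ hσ fun i j hij hadj => ((hσ' i j).1 ⟨hij, hadj⟩).1
  rwa [List.ofFn_get, List.ofFn_get] at this

variable (I)

/-! ### Inverse words -/

/-- The inverse letter. -/
def Letter.inv (a : Letter G) : Letter G := ⟨a.node, a.val⁻¹, inv_ne_one.2 a.ne_one⟩

@[simp] theorem Letter.inv_node (a : Letter G) : a.inv.node = a.node := rfl

@[simp] theorem Letter.inv_inv (a : Letter G) : a.inv.inv = a := by
  cases a; simp only [Letter.inv, mk.injEq, heq_eq_eq, true_and]; exact _root_.inv_inv _

/-- The formal inverse of a word. -/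
def Word.inv (w : Word G) : Word G := (w.map Letter.inv).reverse

@[simp] theorem Word.inv_nil : Word.inv ([] : Word G) = [] := rfl

@[simp] theorem Word.inv_cons (a : Letter G) (w : Word G) :
    Word.inv (a :: w) = Word.inv w ++ [a.inv] := by simp [Word.inv]

@[simp] theorem Word.inv_append (u v : Word G) :
    Word.inv (u ++ v) = Word.inv v ++ Word.inv u := by simp [Word.inv]

@[simp] theorem Word.inv_inv (w : Word G) : Word.inv (Word.inv w) = w := by
  induction w with
  | nil => rfl
  | cons a w ih => simp [ih]

@[simp] theorem Word.length_inv (w : Word G) : (Word.inv w).length = w.length := by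
  simp [Word.inv]

variable {I} in
theorem TraceEq.inv {u v : Word G} (h : TraceEq I u v) :
    TraceEq I (Word.inv u) (Word.inv v) := by
  induction h with
  | nil => exact nil
  | cons a _ ih => simpa using ih.append_right _
  | swap a b u h =>
    simpa using (TraceEq.swap b.inv a.inv [] h.symm).append_left (Word.inv u)
  | trans _ _ ih₁ ih₂ => exact ih₁.trans ih₂

/-! ### Heads of words -/

/-- All letters of the word are independent of the node `α`. -/
def Indep (α : L) (w : Word G) : Prop := ∀ a ∈ w, I.Adj α a.node

variable {I} in
@[simp] theorem indep_nil (α : L) : Indep I α ([] : Word G) := by simp [Indep]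

variable {I} in
@[simp] theorem indep_cons {α : L} {a : Letter G} {w : Word G} :
    Indep I α (a :: w) ↔ I.Adj α a.node ∧ Indep I α w := by simp [Indep]

variable {I} in
@[simp] theorem indep_inv {α : L} {w : Word G} : Indep I α (Word.inv w) ↔ Indep I α w := by
  simp [Indep, Word.inv]

open Classical in
/-- The factor in `G α` with which the trace of `w` begins (`1` if there is none). -/
noncomputable def head (α : L) : Word G → G α
  | [] => 1
  | a :: w => if h : a.node = α then h ▸ a.val else if I.Adj α a.node then head α w else 1

open Classical in
/-- What remains of `w` after the removal of its head at `α`. -/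
noncomputable def rest (α : L) : Word G → Word G
  | [] => []
  | a :: w => if a.node = α then w else if I.Adj α a.node then a :: rest α w else a :: w

open Classical in
/-- The word of length at most one that denotes `g : G α`. -/
noncomputable def single (α : L) (g : G α) : Word G := if h : g = 1 then [] else [⟨α, g, h⟩]

@[simp] theorem single_one (α : L) : single α (1 : G α) = [] := by simp [single]

theorem single_of_ne {α : L} {g : G α} (h : g ≠ 1) : single α g = [⟨α, g, h⟩] := by
  simp [single, h]

@[simp] theorem single_val (a : Letter G) : single a.node a.val = [a] := by
  rw [single_of_ne a.ne_one]

@[simp] theorem head_nil (α : L) : head I α ([] : Word G) = 1 := rfl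

@[simp] theorem head_cons_self (a : Letter G) (w : Word G) : head I a.node (a :: w) = a.val := by
  simp [head]

@[simp] theorem rest_nil (α : L) : rest I α ([] : Word G) = [] := rfl

@[simp] theorem rest_cons_self (a : Letter G) (w : Word G) : rest I a.node (a :: w) = w := by
  simp [rest]

variable {I}

theorem head_cons_of_adj {α : L} {a : Letter G} (h : I.Adj α a.node) (w : Word G) :
    head I α (a :: w) = head I α w := by
  simp [head, h, h.ne']

theorem rest_cons_of_adj {α : L} {a : Letter G} (h : I.Adj α a.node) (w : Word G) :
    rest I α (a :: w) = a :: rest I α w := by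
  simp [rest, h, h.ne']

theorem head_cons_of_not_adj {α : L} {a : Letter G} (h : ¬ I.Adj α a.node) (h' : a.node ≠ α)
    (w : Word G) : head I α (a :: w) = 1 := by
  simp [head, h, h']

theorem rest_cons_of_not_adj {α : L} {a : Letter G} (h : ¬ I.Adj α a.node) (h' : a.node ≠ α)
    (w : Word G) : rest I α (a :: w) = a :: w := by
  simp [rest, h, h']

theorem head_append_of_indep {α : L} {u : Word G} (h : Indep I α u) (v : Word G) :
    head I α (u ++ v) = head I α v := by
  induction u with
  | nil => rfl
  | cons a u ih =>
    rw [indep_cons] at h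
    rw [List.cons_append, head_cons_of_adj h.1, ih h.2]

theorem head_eq_one_of_indep {α : L} {u : Word G} (h : Indep I α u) : head I α u = 1 := by
  simpa using head_append_of_indep h []

theorem head_append_of_not_indep {α : L} {u : Word G} (h : ¬ Indep I α u) (v : Word G) :
    head I α (u ++ v) = head I α u := by
  induction u with
  | nil => simp at h
  | cons a u ih =>
    rw [indep_cons, not_and] at h
    rw [List.cons_append]
    by_cases ha : a.node = α
    · subst ha; simp
    · by_cases hadj : I.Adj α a.node
      · rw [head_cons_of_adj hadj, head_cons_of_adj hadj, ih (h hadj)]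
      · rw [head_cons_of_not_adj hadj ha, head_cons_of_not_adj hadj ha]

theorem head_append_of_head_ne_one {α : L} {u : Word G} (h : head I α u ≠ 1) (v : Word G) :
    head I α (u ++ v) = head I α u :=
  head_append_of_not_indep (fun h' => h (head_eq_one_of_indep h')) v

theorem indep_of_head_append_ne_one {α : L} {u v : Word G} (h : head I α u = 1)
    (h' : head I α (u ++ v) ≠ 1) : Indep I α u := by
  by_contra hn
  exact h' ((head_append_of_not_indep hn v).trans h)

theorem rest_eq_self {α : L} {w : Word G} (h : head I α w = 1) : rest I α w = w := by
  induction w with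
  | nil => rfl
  | cons a w ih =>
    by_cases ha : a.node = α
    · subst ha; exact absurd ((head_cons_self I a w).symm.trans h) a.ne_one
    · by_cases hadj : I.Adj α a.node
      · rw [head_cons_of_adj hadj] at h
        rw [rest_cons_of_adj hadj, ih h]
      · exact rest_cons_of_not_adj hadj ha w

theorem head_rest_of_adj {α β : L} (h : I.Adj α β) (w : Word G) :
    head I α (rest I β w) = head I α w := by
  induction w with
  | nil => rfl
  | cons a w ih =>
    by_cases ha : a.node = β
    · subst ha; rw [rest_cons_self, head_cons_of_adj h]
    · by_cases hadj : I.Adj β a.node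
      · rw [rest_cons_of_adj hadj]
        by_cases ha' : a.node = α
        · subst ha'; simp
        · by_cases hadj' : I.Adj α a.node
          · rw [head_cons_of_adj hadj', head_cons_of_adj hadj', ih]
          · rw [head_cons_of_not_adj hadj' ha', head_cons_of_not_adj hadj' ha']
      · rw [rest_cons_of_not_adj hadj ha]

theorem rest_comm {α β : L} (h : I.Adj α β) (w : Word G) :
    rest I α (rest I β w) = rest I β (rest I α w) := by
  induction w with
  | nil => rfl
  | cons a w ih =>
    by_cases ha : a.node = α
    · subst ha; rw [rest_cons_self, rest_cons_of_adj h.symm, rest_cons_self]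
    by_cases hb : a.node = β
    · subst hb; rw [rest_cons_self, rest_cons_of_adj h, rest_cons_self]
    by_cases hadj : I.Adj α a.node <;> by_cases hadj' : I.Adj β a.node <;>
    simp only [rest_cons_of_adj, rest_cons_of_not_adj, hadj, hadj', ha, hb, ih, ne_eq,
      not_false_eq_true]

theorem TraceEq.head_rest (α : L) {w : Word G} :
    TraceEq I w (single α (head I α w) ++ rest I α w) := by
  induction w with
  | nil => simpa using TraceEq.refl _
  | cons a w ih =>
    by_cases ha : a.node = α
    · subst ha; simpa using TraceEq.refl _
    · by_cases hadj : I.Adj α a.node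
      · rw [head_cons_of_adj hadj, rest_cons_of_adj hadj]
        refine (TraceEq.cons a ih).trans ?_
        by_cases h1 : head I α w = 1
        · simpa [h1] using TraceEq.refl _
        · rw [single_of_ne h1]
          exact TraceEq.swap _ _ _ hadj.symm
      · rw [head_cons_of_not_adj hadj ha, rest_cons_of_not_adj hadj ha]
        simpa using TraceEq.refl _

/-- Two independent letters cannot both come from `α`, so a swap never exchanges candidates for the
head. -/
theorem TraceEq.head_eq (α : L) {u v : Word G} (h : TraceEq I u v) :
    head I α u = head I α v := by
  induction h with
  | nil => rfl
  | cons a _ ih =>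
    by_cases ha : a.node = α
    · subst ha; simp
    · by_cases hadj : I.Adj α a.node
      · rw [head_cons_of_adj hadj, head_cons_of_adj hadj, ih]
      · rw [head_cons_of_not_adj hadj ha, head_cons_of_not_adj hadj ha]
  | swap a b u h =>
    by_cases ha : a.node = α
    · subst ha; rw [head_cons_of_adj h]; simp
    by_cases hb : b.node = α
    · subst hb; rw [head_cons_of_adj h.symm]; simp
    by_cases hadj : I.Adj α a.node <;> by_cases hadj' : I.Adj α b.node <;>
    simp only [head_cons_of_adj, head_cons_of_not_adj, hadj, hadj', ha, hb, ne_eq,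
      not_false_eq_true]
  | trans _ _ ih₁ ih₂ => exact ih₁.trans ih₂

theorem TraceEq.rest (α : L) {u v : Word G} (h : TraceEq I u v) :
    TraceEq I (rest I α u) (GraphProd.rest I α v) := by
  induction h with
  | nil => exact TraceEq.refl _
  | cons a h ih =>
    by_cases ha : a.node = α
    · subst ha; simpa using h
    · by_cases hadj : I.Adj α a.node
      · rw [rest_cons_of_adj hadj, rest_cons_of_adj hadj]; exact TraceEq.cons a ih
      · rw [rest_cons_of_not_adj hadj ha, rest_cons_of_not_adj hadj ha]; exact TraceEq.cons a h
  | swap a b u h =>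
    by_cases ha : a.node = α
    · subst ha; rw [rest_cons_of_adj h]; simpa using TraceEq.refl _
    by_cases hb : b.node = α
    · subst hb; rw [rest_cons_of_adj h.symm]; simpa using TraceEq.refl _
    by_cases hadj : I.Adj α a.node <;> by_cases hadj' : I.Adj α b.node <;>
    simp only [rest_cons_of_adj, rest_cons_of_not_adj, hadj, hadj', ha, hb, ne_eq,
      not_false_eq_true] <;> exact TraceEq.swap a b _ h
  | trans _ _ ih₁ ih₂ => exact ih₁.trans ih₂

/-! ### Reduced words -/

variable (I) in
/-- Recursive form of reducedness: no letter is followed by a letter from the same node up to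
letters independent of both. -/
def Red : Word G → Prop
  | [] => True
  | a :: w => head I a.node w = 1 ∧ Red w

theorem TraceEq.red {u v : Word G} (h : TraceEq I u v) (hu : Red I u) : Red I v := by
  induction h with
  | nil => exact hu
  | cons a h ih => exact ⟨(h.head_eq a.node).symm.trans hu.1, ih hu.2⟩
  | swap a b u h =>
    obtain ⟨h1, h2, h3⟩ := hu
    rw [head_cons_of_adj h] at h1
    exact ⟨(head_cons_of_adj h.symm u).trans h2, h1, h3⟩
  | trans _ _ ih₁ ih₂ => exact ih₂ (ih₁ hu)

theorem Red.head_rest (α : L) {w : Word G} (h : Red I w) : head I α (rest I α w) = 1 := by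
  induction w with
  | nil => rfl
  | cons a w ih =>
    by_cases ha : a.node = α
    · subst ha; simpa using h.1
    · by_cases hadj : I.Adj α a.node
      · rw [rest_cons_of_adj hadj, head_cons_of_adj hadj, ih h.2]
      · rw [rest_cons_of_not_adj hadj ha, head_cons_of_not_adj hadj ha]

theorem Red.rest (α : L) {w : Word G} (h : Red I w) : Red I (rest I α w) := by
  induction w with
  | nil => exact h
  | cons a w ih =>
    by_cases ha : a.node = α
    · subst ha; simpa using h.2
    · by_cases hadj : I.Adj α a.node
      · rw [rest_cons_of_adj hadj]
        exact ⟨(head_rest_of_adj hadj.symm w).trans h.1, ih h.2⟩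
      · rw [rest_cons_of_not_adj hadj ha]; exact h

theorem Red.single_append {α : L} (g : G α) {w : Word G} (h : Red I w) (h1 : head I α w = 1) :
    Red I (single α g ++ w) := by
  by_cases hg : g = 1
  · simpa [hg] using h
  · rw [single_of_ne hg]; exact ⟨h1, h⟩

/-- If the new `a` met a letter `b` of its own node, everything after `b` in `w` would be
independent of that node, making `b` the last letter of `w` there. -/
theorem Red.concat {a : Letter G} {w : Word G} (h : Red I w)
    (h1 : head I a.node (Word.inv w) = 1) : Red I (w ++ [a]) := by
  induction w with
  | nil => exact ⟨rfl, trivial⟩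
  | cons b w ih =>
    rw [Word.inv_cons] at h1
    refine ⟨?_, ih h.2 ?_⟩
    · by_contra hne
      have hi := indep_of_head_append_ne_one h.1 hne
      rw [List.append_eq, head_append_of_indep hi] at hne
      by_cases hab : a.node = b.node
      · rw [← hab] at hi
        rw [head_append_of_indep (indep_inv.2 hi), hab] at h1
        exact b.inv.ne_one ((head_cons_self I b.inv []).symm.trans h1)
      · by_cases hadj : I.Adj b.node a.node
        · exact hne (by rw [head_cons_of_adj hadj, head_nil])
        · exact hne (head_cons_of_not_adj hadj hab _)
    · by_contra hne
      exact hne ((head_append_of_head_ne_one hne _).symm.trans h1)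

theorem Red.inv {w : Word G} (h : Red I w) : Red I (Word.inv w) := by
  induction w with
  | nil => exact h
  | cons a w ih =>
    rw [Word.inv_cons]
    refine (ih h.2).concat ?_
    rw [Word.inv_inv]
    exact h.1

/-! ### The action on reduced words -/

variable (I) in
/-- Left multiplication of a reduced word by an element of a node group. -/
noncomputable def act (α : L) (g : G α) (w : Word G) : Word G :=
  single α (g * head I α w) ++ rest I α w

theorem head_single_append {α : L} (g : G α) {w : Word G} (h1 : head I α w = 1) :
    head I α (single α g ++ w) = g := by
  by_cases hg : g = 1
  · simpa [hg] using h1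
  · rw [single_of_ne hg]; exact head_cons_self I ⟨α, g, hg⟩ w

theorem rest_single_append {α : L} (g : G α) {w : Word G} (h1 : head I α w = 1) :
    rest I α (single α g ++ w) = w := by
  by_cases hg : g = 1
  · simpa [hg] using rest_eq_self h1
  · rw [single_of_ne hg]; exact rest_cons_self I ⟨α, g, hg⟩ w

theorem head_single_append_of_adj {α β : L} (h : I.Adj α β) (g : G β) (w : Word G) :
    head I α (single β g ++ w) = head I α w := by
  by_cases hg : g = 1
  · simp [hg]
  · rw [single_of_ne hg]; exact head_cons_of_adj (a := ⟨β, g, hg⟩) h w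

theorem rest_single_append_of_adj {α β : L} (h : I.Adj α β) (g : G β) (w : Word G) :
    rest I α (single β g ++ w) = single β g ++ rest I α w := by
  by_cases hg : g = 1
  · simp [hg]
  · rw [single_of_ne hg]; exact rest_cons_of_adj (a := ⟨β, g, hg⟩) h w

theorem Red.act {α : L} (g : G α) {w : Word G} (h : Red I w) : Red I (act I α g w) :=
  (h.rest α).single_append _ (h.head_rest α)

theorem TraceEq.act {α : L} (g : G α) {u v : Word G} (h : TraceEq I u v) :
    TraceEq I (act I α g u) (GraphProd.act I α g v) := by
  unfold GraphProd.act
  rw [h.head_eq α]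
  exact (h.rest α).append_left _

theorem head_act {α : L} (g : G α) {w : Word G} (h : Red I w) :
    head I α (act I α g w) = g * head I α w :=
  head_single_append _ (h.head_rest α)

theorem head_act_of_adj {α β : L} (h : I.Adj α β) (g : G β) (w : Word G) :
    head I α (act I β g w) = head I α w := by
  rw [act, head_single_append_of_adj h, head_rest_of_adj h]

/-- Only a trace equivalence, since the head may be moved to the front. The node groups therefore
act on reduced traces rather than on reduced words. -/
theorem act_one (α : L) (w : Word G) : TraceEq I (act I α 1 w) w := by
  rw [act, one_mul]; exact (TraceEq.head_rest α).symm

theorem act_mul {α : L} (g h : G α) {w : Word G} (hw : Red I w) :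
    act I α (g * h) w = act I α g (act I α h w) := by
  rw [act, act, head_act h hw, mul_assoc, act, rest_single_append _ (hw.head_rest α)]

theorem act_comm {α β : L} (h : I.Adj α β) (g : G α) (k : G β) (w : Word G) :
    TraceEq I (act I α g (act I β k w)) (act I β k (act I α g w)) := by
  rw [act, head_act_of_adj h, act.eq_def I β k (act I α g w), head_act_of_adj h.symm, act,
    rest_single_append_of_adj h, act, rest_single_append_of_adj h.symm, rest_comm h]
  generalize g * head I α w = g'
  generalize k * head I β w = k'
  by_cases hg : g' = 1
  · simpa [hg] using TraceEq.refl _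
  by_cases hk : k' = 1
  · simpa [hk] using TraceEq.refl _
  rw [single_of_ne hg, single_of_ne hk]
  exact TraceEq.swap _ _ _ h

theorem act_cons {a : Letter G} {w : Word G} (h : Red I (a :: w)) :
    act I a.node a.val w = a :: w := by
  rw [act, h.1, rest_eq_self h.1]; simp

variable (I G) in
/-- Trace equivalence on reduced words. -/
def redSetoid : Setoid {w : Word G // Red I w} where
  r u v := TraceEq I u.1 v.1
  iseqv := ⟨fun u => TraceEq.refl u.1, TraceEq.symm, TraceEq.trans⟩

variable (I G) in
/-- Reduced traces. -/
def RedTrace : Type (max u v) := Quotient (redSetoid G I)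

/-- The reduced trace of a reduced word. -/
def RedTrace.mk (w : Word G) (h : Red I w) : RedTrace G I := Quotient.mk (redSetoid G I) ⟨w, h⟩

variable (I) in
/-- The action of a node group on reduced traces. -/
noncomputable def actHom (α : L) : G α →* Function.End (RedTrace G I) where
  toFun g := Quotient.map' (s₁ := redSetoid G I) (s₂ := redSetoid G I)
    (fun w => ⟨act I α g w.1, w.2.act g⟩) fun _ _ h => TraceEq.act g h
  map_one' := by
    funext x
    induction x using Quotient.inductionOn with
    | h w => exact Quotient.sound (s := redSetoid G I) (act_one α w.1)
  map_mul' g h := by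
    funext x
    induction x using Quotient.inductionOn with
    | h w => exact congrArg (Quotient.mk (redSetoid G I)) (Subtype.ext (act_mul g h w.2))

theorem actHom_comm {α β : L} (h : I.Adj α β) (g : G α) (k : G β) :
    actHom I α g * actHom I β k = actHom I β k * actHom I α g := by
  funext x
  induction x using Quotient.inductionOn with
  | h w => exact Quotient.sound (s := redSetoid G I) (act_comm h g k w.1)

/-- The embedding of a node group into the graph product. -/
def ofNode (I : SimpleGraph L) (α : L) : G α →* GraphProduct I G :=
  (QuotientGroup.mk' _).comp Monoid.CoprodI.of

theorem ofNode_comm {α β : L} (h : I.Adj α β) (g : G α) (k : G β) :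
    ofNode I α g * ofNode I β k = ofNode I β k * ofNode I α g := by
  have : ofNode I α g * ofNode I β k * (ofNode I α g)⁻¹ * (ofNode I β k)⁻¹ = 1 :=
    (QuotientGroup.eq_one_iff _).2 (Subgroup.subset_normalClosure ⟨α, β, g, k, h, rfl⟩)
  rwa [mul_inv_eq_one, mul_inv_eq_iff_eq_mul] at this

variable (I G) in
/-- The action of the graph product on reduced traces. -/
noncomputable def graphAct : GraphProduct I G →* Function.End (RedTrace G I) :=
  QuotientGroup.lift _ (Monoid.CoprodI.lift (actHom I)) (by
    intro w hw
    refine (Subgroup.normalClosure_le_normal (N := MonoidHom.ker _) ?_) hw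
    rintro _ ⟨α, β, g, k, h, rfl⟩
    rw [SetLike.mem_coe, MonoidHom.mem_ker, ← map_inv, ← map_inv]
    simp only [map_mul, Monoid.CoprodI.lift_of]
    rw [actHom_comm h, mul_assoc (actHom I β k), ← map_mul, mul_inv_cancel, map_one, mul_one,
      ← map_mul, mul_inv_cancel, map_one])

theorem graphAct_ofNode {α : L} (g : G α) : graphAct G I (ofNode I α g) = actHom I α g :=
  Monoid.CoprodI.lift_of _ _

theorem graphAct_mul (g h : GraphProduct I G) (x : RedTrace G I) :
    graphAct G I (g * h) x = graphAct G I g (graphAct G I h x) :=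
  congrFun (map_mul (graphAct G I) g h) x

theorem toGroup_nil : Word.toGroup I ([] : Word G) = 1 := rfl

theorem toGroup_cons (a : Letter G) (w : Word G) :
    Word.toGroup I (a :: w) = ofNode I a.node a.val * Word.toGroup I w := rfl

theorem toGroup_append (u v : Word G) :
    Word.toGroup I (u ++ v) = Word.toGroup I u * Word.toGroup I v := by
  simp [Word.toGroup]

theorem toGroup_singleton (a : Letter G) : Word.toGroup I [a] = ofNode I a.node a.val := by
  rw [toGroup_cons, toGroup_nil, mul_one]

theorem toGroup_inv (w : Word G) : Word.toGroup I (Word.inv w) = (Word.toGroup I w)⁻¹ := by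
  induction w with
  | nil => simp [toGroup_nil]
  | cons a w ih =>
    rw [Word.inv_cons, toGroup_append, ih, toGroup_singleton, toGroup_cons, mul_inv_rev]
    exact congrArg _ (map_inv _ _)

theorem TraceEq.toGroup_eq {u v : Word G} (h : TraceEq I u v) :
    Word.toGroup I u = Word.toGroup I v := by
  induction h with
  | nil => rfl
  | cons a _ ih => rw [toGroup_cons, toGroup_cons, ih]
  | swap a b u h =>
    simp only [toGroup_cons]
    rw [← mul_assoc, ofNode_comm h, mul_assoc]
  | trans _ _ ih₁ ih₂ => exact ih₁.trans ih₂

theorem ofNode_comm_toGroup {α : L} (g : G α) {w : Word G} (h : Indep I α w) :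
    ofNode I α g * Word.toGroup I w = Word.toGroup I w * ofNode I α g := by
  induction w with
  | nil => simp [toGroup_nil]
  | cons a w ih =>
    rw [indep_cons] at h
    rw [toGroup_cons, ← mul_assoc, ofNode_comm h.1, mul_assoc, ih h.2, mul_assoc]

/-- The reduced form of the product of two words, the second of which is reduced. -/
noncomputable def redMul (I : SimpleGraph L) (u v : Word G) : Word G :=
  u.foldr (fun a w => act I a.node a.val w) v

theorem redMul_cons (a : Letter G) (u v : Word G) :
    redMul I (a :: u) v = act I a.node a.val (redMul I u v) := rfl

theorem Red.redMul (u : Word G) {v : Word G} (h : Red I v) : Red I (redMul I u v) := by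
  induction u with
  | nil => exact h
  | cons a u ih => exact ih.act a.val

theorem graphAct_toGroup (u : Word G) {v : Word G} (h : Red I v) :
    graphAct G I (Word.toGroup I u) (RedTrace.mk v h) =
      RedTrace.mk (redMul I u v) (h.redMul u) := by
  induction u with
  | nil => rw [toGroup_nil, map_one]; rfl
  | cons a u ih =>
    rw [toGroup_cons, graphAct_mul, ih, graphAct_ofNode]
    rfl

/-- Each letter of a reduced word meets a trivial head, so the action rebuilds the word letter by
letter. -/
theorem redMul_nil {w : Word G} (h : Red I w) : redMul I w [] = w := by
  induction w with
  | nil => rfl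
  | cons a w ih => rw [redMul_cons, ih h.2, act_cons h]

/-- Products of reduced words with equal values have trace equivalent reduced forms. -/
theorem traceEq_redMul {u v u' v' : Word G} (hv : Red I v) (hv' : Red I v')
    (h : Word.toGroup I u * Word.toGroup I v = Word.toGroup I u' * Word.toGroup I v') :
    TraceEq I (redMul I u v) (redMul I u' v') := by
  -- The value of a product determines its reduced form: let it act on the empty trace.
  have key : ∀ (a b : Word G) (hb : Red I b),
      graphAct G I (Word.toGroup I a * Word.toGroup I b) (RedTrace.mk [] trivial) =
        RedTrace.mk (redMul I a b) (hb.redMul a) := by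
    intro a b hb
    have hb' := graphAct_toGroup (I := I) b (v := []) trivial
    simp only [redMul_nil hb] at hb'
    rw [graphAct_mul, hb', graphAct_toGroup]
  have := (key u v hv).symm.trans ((congrArg _ h |> fun e => congrFun e _).trans (key u' v' hv'))
  exact Quotient.exact (s := redSetoid G I) this

/-- The normal form theorem for graph products. -/
theorem traceEq_of_toGroup_eq {u v : Word G} (hu : Red I u) (hv : Red I v)
    (h : Word.toGroup I u = Word.toGroup I v) : TraceEq I u v :=
  traceEq_redMul (u := []) (u' := []) hu hv (by rw [h])

/-! ### Heads of products without cancellation -/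

variable (I) in
/-- No last letter of `u` is the inverse of a first letter of `v`. -/
def NoCancel (u v : Word G) : Prop :=
  ∀ α, head I α (Word.inv u) = head I α v → head I α v = 1

/-- A nontrivial last letter of `u` at `α` remains the last one there when `a` is put in front. -/
theorem NoCancel.of_cons {a : Letter G} {u v : Word G} (h : NoCancel I (a :: u) v) :
    NoCancel I u v := by
  intro α hα
  by_contra hne
  refine hne (h α ?_)
  rw [Word.inv_cons, head_append_of_head_ne_one (by rwa [hα]), hα]

theorem head_redMul_of_indep {α : L} {u : Word G} (h : Indep I α u) (v : Word G) :
    head I α (redMul I u v) = head I α v := by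
  induction u with
  | nil => rfl
  | cons a u ih =>
    rw [indep_cons] at h
    rw [redMul_cons, head_act_of_adj h.1, ih h.2]

/-- If there is no cancellation in `u * v` and `u` has no head at `α`, then `u * v` can only have
one if `α` commutes with `u`. Letters of `u` are not cancelled. -/
theorem head_redMul {u v : Word G} (hu : Red I u) (hv : Red I v) (h : NoCancel I u v) :
    (∀ α, head I α u ≠ 1 → head I α (redMul I u v) ≠ 1) ∧
      ∀ α, head I α u = 1 → head I α (redMul I u v) ≠ 1 → Indep I α u := by
  induction u with
  | nil => simp
  | cons a u ih =>
    obtain ⟨ih1, ih2⟩ := ih hu.2 h.of_cons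
    have hr := hv.redMul (I := I) u
    -- If `a` were cancelled, its inverse would be the head of `u * v` at that node. As `u` has no
    -- head there, it commutes with the node, so the inverse is already the head of `v`, while `a`
    -- is a last letter of `a :: u`.
    have hself : head I a.node (redMul I (a :: u) v) ≠ 1 := by
      rw [redMul_cons, head_act _ hr]
      intro h1
      have hinv : head I a.node (redMul I u v) = a.val⁻¹ := (inv_eq_of_mul_eq_one_right h1).symm
      have hne : a.val⁻¹ ≠ 1 := inv_ne_one.2 a.ne_one
      have hi := ih2 a.node hu.1 (by rwa [hinv])
      rw [head_redMul_of_indep hi] at hinv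
      refine hne (hinv.symm.trans (h a.node ?_))
      rw [Word.inv_cons, head_append_of_indep (indep_inv.2 hi), hinv]
      exact head_cons_self I a.inv []
    -- The surviving letter at `a.node` blocks every other node dependent on it.
    have hnadj : ∀ α, a.node ≠ α → ¬ I.Adj α a.node → head I α (redMul I (a :: u) v) = 1 := by
      intro α ha hadj
      rw [redMul_cons, act, ← head_act _ hr, ← redMul_cons, single_of_ne hself]
      exact head_cons_of_not_adj (a := ⟨a.node, _, hself⟩) hadj ha _
    constructor
    · intro α hα
      by_cases ha : a.node = α
      · subst ha; exact hself
      by_cases hadj : I.Adj α a.node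
      · rw [redMul_cons, head_act_of_adj hadj]
        rw [head_cons_of_adj hadj] at hα
        exact ih1 α hα
      · exact absurd (head_cons_of_not_adj hadj ha u) hα
    · intro α hα hne
      by_cases ha : a.node = α
      · subst ha; exact absurd ((head_cons_self I a u).symm.trans hα) a.ne_one
      by_cases hadj : I.Adj α a.node
      · rw [redMul_cons, head_act_of_adj hadj] at hne
        rw [head_cons_of_adj hadj] at hα
        exact indep_cons.2 ⟨hadj, ih2 α hα hne⟩
      · exact absurd (hnadj α ha hadj) hne

/-! ### Conjugacy -/

theorem Transposed.symm {u v : Word G} (h : Transposed I u v) : Transposed I v u := by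
  obtain ⟨r, s, h1, h2⟩ := h
  exact ⟨s, r, h2, h1⟩

theorem Transposed.inv {u v : Word G} (h : Transposed I u v) :
    Transposed I (Word.inv u) (Word.inv v) := by
  obtain ⟨r, s, h1, h2⟩ := h
  refine ⟨Word.inv s, Word.inv r, ?_, ?_⟩
  · rw [← Word.inv_append]; exact h1.traceEq.inv.depIso
  · rw [← Word.inv_append]; exact h2.traceEq.inv.depIso

theorem TranspositionEquiv.symm {u v : Word G} (h : TranspositionEquiv I u v) :
    TranspositionEquiv I v u := by
  induction h with
  | single h => exact .single h.symm
  | tail _ h ih => exact .head h.symm ih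

theorem TranspositionEquiv.inv {u v : Word G} (h : TranspositionEquiv I u v) :
    TranspositionEquiv I (Word.inv u) (Word.inv v) := by
  induction h with
  | single h => exact .single h.inv
  | tail _ h ih => exact .tail ih h.inv

/-- A transitive closure need not be reflexive; the transposition with empty `r` supplies the step.
-/
theorem TraceEq.transpositionEquiv {u v : Word G} (h : TraceEq I u v) :
    TranspositionEquiv I u v :=
  .single ⟨[], u, DepIso.refl I u, by simpa using h.symm.depIso⟩

variable (I) in
/-- Reduced words without a node at both ends of the trace. -/
def CycRed (w : Word G) : Prop :=
  Red I w ∧ ∀ α, head I α w = 1 ∨ head I α (Word.inv w) = 1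

theorem CycRed.inv {w : Word G} (h : CycRed I w) : CycRed I (Word.inv w) :=
  ⟨h.1.inv, fun α => by rw [Word.inv_inv]; exact (h.2 α).symm⟩

theorem TraceEq.cycRed {u v : Word G} (h : TraceEq I u v) (hu : CycRed I u) : CycRed I v :=
  ⟨h.red hu.1, fun α => by rw [← h.head_eq, ← h.inv.head_eq]; exact hu.2 α⟩

/-- Since `a` is not also a last letter, some letter of `w` depends on it and keeps the moved `a`
from being a first letter. Nodes independent of `a` keep their ends, and the other nodes are blocked
at the right end by `a`. -/
theorem CycRed.rotate {a : Letter G} {w : Word G} (h : CycRed I (a :: w)) :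
    CycRed I (w ++ [a]) := by
  have htail : head I a.node (Word.inv w ++ [a.inv]) = 1 := by
    rcases h.2 a.node with h1 | h1
    · exact absurd ((head_cons_self I a w).symm.trans h1) a.ne_one
    · simpa using h1
  have hni : ¬ Indep I a.node w := fun hi => a.inv.ne_one <| by
    rw [head_append_of_indep (indep_inv.2 hi)] at htail
    exact (head_cons_self I a.inv []).symm.trans htail
  rw [head_append_of_not_indep (by rwa [indep_inv])] at htail
  refine ⟨h.1.2.concat htail, fun α => ?_⟩
  by_cases ha : a.node = α
  · subst ha
    left
    rw [head_append_of_not_indep hni]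
    exact h.1.1
  by_cases hadj : I.Adj α a.node
  · have h2 := h.2 α
    rw [head_cons_of_adj hadj, Word.inv_cons] at h2
    rw [Word.inv_append, Word.inv_cons, Word.inv_nil, List.nil_append, List.singleton_append,
      head_cons_of_adj (a := a.inv) hadj]
    have h3 : ∀ (u : Word G) (b : Letter G), I.Adj α b.node →
        head I α (u ++ [b]) = head I α u := by
      intro u b hb
      by_cases hi : Indep I α u
      · rw [head_append_of_indep hi, head_eq_one_of_indep hi, head_cons_of_adj hb, head_nil]
      · exact head_append_of_not_indep hi _
    rw [h3 _ _ hadj]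
    rwa [h3 _ a.inv hadj] at h2
  · right
    rw [Word.inv_append, Word.inv_cons, Word.inv_nil, List.nil_append, List.singleton_append]
    exact head_cons_of_not_adj (a := a.inv) hadj ha _

theorem TraceEq.cons_rest {α : L} {w : Word G} (h : head I α w ≠ 1) :
    TraceEq I w (⟨α, head I α w, h⟩ :: GraphProd.rest I α w) := by
  have := TraceEq.head_rest (I := I) α (w := w)
  rwa [single_of_ne h] at this

/-- If `x` and `w` share their head at `α`, then conjugation by it rotates `x` and shortens `w`. -/
theorem exists_shorter_of_head_eq {α : L} {x y w : Word G} (hx : CycRed I x) (hw : Red I w)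
    (heq : Word.toGroup I w * Word.toGroup I y = Word.toGroup I x * Word.toGroup I w)
    (hhead : head I α x = head I α w) (hne : head I α w ≠ 1) :
    ∃ x' w' : Word G, CycRed I x' ∧ Red I w' ∧ w'.length < w.length ∧ Transposed I x x' ∧
      Word.toGroup I w' * Word.toGroup I y = Word.toGroup I x' * Word.toGroup I w' := by
  have hne' : head I α x ≠ 1 := by rwa [hhead]
  have hxt := TraceEq.cons_rest hne'
  have hwt := TraceEq.cons_rest hne
  refine ⟨_, _, (hxt.cycRed hx).rotate, hw.rest α, ?_,
    ⟨[_], _, hxt.depIso, DepIso.refl I _⟩, ?_⟩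
  · rw [hwt.perm.length_eq]; simp
  · rw [hxt.toGroup_eq, hwt.toGroup_eq, toGroup_cons, toGroup_cons] at heq
    rw [toGroup_append, toGroup_singleton]
    simp only [hhead] at heq ⊢
    simpa only [mul_assoc, mul_right_inj] using heq

/-- The first letter of `w` at `α` survives in `w y = x w`; a head of `x w` at `α` comes either from
`x` or from `w` past all of `x`. -/
theorem head_ne_one_or_indep {α : L} {x y w : Word G} (hx : Red I x) (hy : Red I y)
    (hw : Red I w)
    (heq : Word.toGroup I w * Word.toGroup I y = Word.toGroup I x * Word.toGroup I w)
    (h1 : NoCancel I x w) (h2 : NoCancel I w y) (hα : head I α w ≠ 1) :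
    head I α x ≠ 1 ∨ Indep I α x := by
  by_contra! h
  refine h.2 ((head_redMul hx hw h1).2 α h.1 ?_)
  rw [← (traceEq_redMul hy hw heq).head_eq]
  exact (head_redMul hw hy h2).1 α hα

/-- Conjugate cyclically reduced words are related by transpositions. -/
theorem transpositionEquiv_of_conj (n : ℕ) : ∀ x y w : Word G, w.length = n → CycRed I x →
    CycRed I y → Red I w →
    Word.toGroup I w * Word.toGroup I y = Word.toGroup I x * Word.toGroup I w →
    TranspositionEquiv I x y := by
  induction n using Nat.strong_induction_on with
  | _ n ih =>
  have step : ∀ x y w : Word G, w.length = n → CycRed I x → CycRed I y → Red I w →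
      Word.toGroup I w * Word.toGroup I y = Word.toGroup I x * Word.toGroup I w →
      (∃ α, head I α x = head I α w ∧ head I α w ≠ 1) → TranspositionEquiv I x y := by
    rintro x y w rfl hx hy hw heq ⟨α, hα, hne⟩
    obtain ⟨x', w', hx', hw', hlt, ht, heq'⟩ := exists_shorter_of_head_eq hx hw heq hα hne
    exact .head ht (ih _ hlt x' y w' rfl hx' hy hw' heq')
  have inv_eq : ∀ x y w : Word G,
      Word.toGroup I w * Word.toGroup I y = Word.toGroup I x * Word.toGroup I w →
      Word.toGroup I w * Word.toGroup I (Word.inv y) =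
        Word.toGroup I (Word.inv x) * Word.toGroup I w := by
    intro x y w h
    rw [toGroup_inv, toGroup_inv, eq_inv_mul_iff_mul_eq, ← mul_assoc, ← h, mul_inv_cancel_right]
  have swap_eq : ∀ x y w : Word G,
      Word.toGroup I w * Word.toGroup I y = Word.toGroup I x * Word.toGroup I w →
      Word.toGroup I (Word.inv w) * Word.toGroup I x =
        Word.toGroup I y * Word.toGroup I (Word.inv w) := by
    intro x y w h
    rw [toGroup_inv, inv_mul_eq_iff_eq_mul, ← mul_assoc, h, mul_inv_cancel_right]
  rintro x y w hn hx hy hw heq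
  have hn' : (Word.inv w).length = n := by simpa using hn
  -- The four symmetric forms of the equation, with (`x`, `y`, `w`) replaced by (`x⁻¹`, `y⁻¹`, `w`),
  -- (`y`, `x`, `w⁻¹`) and (`y⁻¹`, `x⁻¹`, `w⁻¹`).
  by_cases c1 : ∃ α, head I α x = head I α w ∧ head I α w ≠ 1
  · exact step x y w hn hx hy hw heq c1
  by_cases c2 : ∃ α, head I α (Word.inv x) = head I α w ∧ head I α w ≠ 1
  · simpa using (step _ _ w hn hx.inv hy.inv hw (inv_eq _ _ _ heq) c2).inv
  by_cases c3 : ∃ α, head I α y = head I α (Word.inv w) ∧ head I α (Word.inv w) ≠ 1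
  · exact (step y x _ hn' hy hx hw.inv (swap_eq _ _ _ heq) c3).symm
  by_cases c4 : ∃ α, head I α (Word.inv y) = head I α (Word.inv w) ∧ head I α (Word.inv w) ≠ 1
  · simpa using
      (step _ _ _ hn' hy.inv hx.inv hw.inv (swap_eq _ _ _ (inv_eq _ _ _ heq)) c4).inv.symm
  -- The negations now say that `x⁻¹ w`, `x w`, `w y` and `w y⁻¹`, in this order, are free of
  -- cancellation.
  push Not at c1 c2 c3 c4
  cases w with
  | nil =>
    rw [toGroup_nil, one_mul, mul_one] at heq
    exact (traceEq_of_toGroup_eq hx.1 hy.1 heq.symm).transpositionEquiv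
  | cons a w =>
    have hne : head I a.node (a :: w) ≠ 1 := by rw [head_cons_self]; exact a.ne_one
    have k1 := head_ne_one_or_indep hx.1 hy.1 hw heq c2
      (fun α h => by rw [← h]; exact c3 α h.symm) hne
    have k2 := head_ne_one_or_indep hx.inv.1 hy.inv.1 hw (inv_eq _ _ _ heq)
      (by simpa [NoCancel] using c1)
      (fun α h => by rw [← h]; exact c4 α h.symm) hne
    rw [indep_inv] at k2
    -- `x` cannot have both a first and a last letter at the node of `a`.
    have hi : Indep I a.node x := by
      rcases k1 with k1 | k1
      · rcases k2 with k2 | k2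
        · exact absurd (hx.2 a.node) (by simp [k1, k2])
        · exact k2
      · exact k1
    refine ih w.length (by simp [← hn]) x y w rfl hx hy hw.2 ?_
    rw [toGroup_cons, ← mul_assoc (Word.toGroup I x), ← ofNode_comm_toGroup a.val hi, mul_assoc,
      mul_assoc] at heq
    exact mul_left_cancel heq

/-! ### The conditions on dependence graphs -/

theorem exists_get_of_head_ne_one {α : L} {w : Word G} (h : head I α w ≠ 1) :
    ∃ j : Fin w.length, (w.get j).node = α ∧ ∀ k < j, I.Adj α (w.get k).node := by
  induction w with
  | nil => exact absurd rfl h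
  | cons a w ih =>
    by_cases ha : a.node = α
    · exact ⟨(0 : Fin (w.length + 1)), ha, fun k hk => absurd hk (Fin.not_lt_zero k)⟩
    by_cases hadj : I.Adj α a.node
    · rw [head_cons_of_adj hadj] at h
      obtain ⟨j, hj, hk⟩ := ih h
      refine ⟨Fin.succ j, hj, fun k => ?_⟩
      induction k using Fin.cases with
      | zero => exact fun _ => hadj
      | succ k => exact fun h => hk k (Fin.succ_lt_succ_iff.1 h)
    · exact absurd (head_cons_of_not_adj hadj ha w) h

/-- A head of the inverse word is a maximal vertex of the dependence graph of `w`. -/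
theorem exists_get_of_head_inv_ne_one {α : L} {w : Word G} (h : head I α (Word.inv w) ≠ 1) :
    ∃ j : Fin w.length, (w.get j).node = α ∧ ∀ k, j < k → I.Adj α (w.get k).node := by
  induction w with
  | nil => exact absurd rfl h
  | cons a w ih =>
    rw [Word.inv_cons] at h
    by_cases h1 : head I α (Word.inv w) = 1
    · have hi := indep_of_head_append_ne_one h1 h
      rw [head_append_of_indep hi] at h
      rw [indep_inv] at hi
      refine ⟨(0 : Fin (w.length + 1)), ?_, fun k => ?_⟩
      · by_contra ha
        refine h ?_
        by_cases hadj : I.Adj α a.node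
        · exact head_cons_of_adj (a := a.inv) hadj []
        · exact head_cons_of_not_adj (a := a.inv) hadj ha []
      · induction k using Fin.cases with
        | zero => exact fun h => absurd h (lt_irrefl _)
        | succ k => exact fun _ => hi _ (List.get_mem w k)
    · obtain ⟨j, hj, hk⟩ := ih h1
      refine ⟨Fin.succ j, hj, fun k => ?_⟩
      induction k using Fin.cases with
      | zero => exact fun h => absurd h (Fin.not_lt_zero _)
      | succ k => exact fun h => hk k (Fin.succ_lt_succ_iff.1 h)

theorem IsReduced.of_cons {a : Letter G} {w : Word G} (h : IsReduced I (a :: w)) :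
    IsReduced I w := by
  intro i j hij
  refine h (Fin.succ i) (Fin.succ j) ⟨⟨Fin.succ_lt_succ_iff.2 hij.1.1, hij.1.2⟩, ?_⟩
  rintro ⟨k, h1, h2⟩
  induction k using Fin.cases with
  | zero => exact absurd h1.1 (Fin.not_lt_zero _)
  | succ k =>
    exact hij.2 ⟨k, ⟨Fin.succ_lt_succ_iff.1 h1.1, h1.2⟩, ⟨Fin.succ_lt_succ_iff.1 h2.1, h2.2⟩⟩

theorem IsReduced.red {w : Word G} (h : IsReduced I w) : Red I w := by
  induction w with
  | nil => trivial
  | cons a w ih =>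
    refine ⟨?_, ih h.of_cons⟩
    by_contra hne
    obtain ⟨j, hj, hk⟩ := exists_get_of_head_ne_one hne
    -- All letters before `j` are independent of the node, so no vertex lies between the two and the
    -- arc belongs to the Hasse diagram.
    refine h (0 : Fin (w.length + 1)) (Fin.succ j) ⟨⟨Fin.succ_pos j, ?_⟩, ?_⟩ hj.symm
    · intro hadj
      exact hadj.ne hj.symm
    · rintro ⟨k, h1, h2⟩
      induction k using Fin.cases with
      | zero => exact absurd h1.1 (lt_irrefl _)
      | succ k => exact h1.2 (hk k (Fin.succ_lt_succ_iff.1 h2.1))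

theorem IsCyclicallyReduced.cycRed {w : Word G} (h : IsCyclicallyReduced I w)
    (hc : IsConnected I w) (hcard : 2 ≤ (al w).ncard) : CycRed I w := by
  refine ⟨h.1.red, fun α => ?_⟩
  by_contra! hne
  obtain ⟨i, hi, hi'⟩ := exists_get_of_head_ne_one hne.1
  obtain ⟨j, hj, hj'⟩ := exists_get_of_head_inv_ne_one hne.2
  -- The given condition only excludes distinct vertices. If they coincide, all other letters are
  -- independent of `α`, so `α` is isolated in the dependence graph on the alphabet.
  have hij : i = j := by
    by_contra hij
    refine h.2 i j (fun k hk => hk.2 ?_) (fun k hk => hk.2 ?_) hij (hi.trans hj.symm)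
    · rw [hi]; exact (hi' k hk.1).symm
    · rw [hj]; exact hj' k hk.1
  subst hij
  have hα : α ∈ al w := ⟨_, List.get_mem w i, hi⟩
  obtain ⟨β, hβ, hβα⟩ := Set.exists_ne_of_one_lt_ncard hcard α
  -- The first edge of a walk from `α` to another node of the alphabet.
  have hex : ∃ γ : al w, (Iᶜ.induce (al w)).Adj ⟨α, hα⟩ γ := by
    obtain ⟨p⟩ := hc.preconnected ⟨α, hα⟩ ⟨β, hβ⟩
    cases p with
    | nil => exact absurd rfl hβα
    | cons h _ => exact ⟨_, h⟩
  obtain ⟨⟨γ, hγ⟩, hadj⟩ := hex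
  rw [SimpleGraph.comap_adj, Function.Embedding.subtype_apply, Function.Embedding.subtype_apply,
    SimpleGraph.compl_adj] at hadj
  obtain ⟨b, hb, rfl⟩ := hγ
  obtain ⟨k, rfl⟩ := List.get_of_mem hb
  rcases lt_trichotomy k i with hk | hk | hk
  · exact hadj.2 (hi' k hk)
  · subst hk; exact hadj.1 hi.symm
  · exact hadj.2 (hj' k hk)

theorem Transposed.isConj {u v : Word G} (h : Transposed I u v) :
    IsConj (Word.toGroup I u) (Word.toGroup I v) := by
  obtain ⟨r, s, h1, h2⟩ := h
  rw [h1.traceEq.toGroup_eq, h2.traceEq.toGroup_eq, toGroup_append, toGroup_append]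
  exact isConj_iff.2 ⟨(Word.toGroup I r)⁻¹, by group⟩

theorem TranspositionEquiv.isConj {u v : Word G} (h : TranspositionEquiv I u v) :
    IsConj (Word.toGroup I u) (Word.toGroup I v) := by
  induction h with
  | single h => exact h.isConj
  | tail _ h ih => exact ih.trans h.isConj

/-- Every element of the graph product is denoted by a reduced word. -/
theorem exists_red_toGroup (g : GraphProduct I G) :
    ∃ w : Word G, Red I w ∧ Word.toGroup I w = g := by
  have hact : ∀ (α : L) (g : G α) (w : Word G),
      Word.toGroup I (act I α g w) = ofNode I α g * Word.toGroup I w := by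
    have hs : ∀ (α : L) (g : G α), Word.toGroup I (single α g) = ofNode I α g := by
      intro α g
      by_cases hg : g = 1
      · rw [hg, single_one, map_one, toGroup_nil]
      · rw [single_of_ne hg, toGroup_singleton]
    intro α g w
    rw [(TraceEq.head_rest (I := I) α (w := w)).toGroup_eq, act, toGroup_append, toGroup_append,
      hs, hs, map_mul, mul_assoc]
  induction g using QuotientGroup.induction_on with
  | H x =>
    -- An arbitrary reduced `w` on the right lets the factors of a product act one after the other.
    have key : ∀ (x : Monoid.CoprodI G) (w : Word G), Red I w →
        ∃ w' : Word G, Red I w' ∧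
          Word.toGroup I w' = (x : GraphProduct I G) * Word.toGroup I w := by
      intro x
      induction x using Monoid.CoprodI.induction_on with
      | one => exact fun w hw => ⟨w, hw, (one_mul _).symm⟩
      | of α g => exact fun w hw => ⟨act I α g w, hw.act g, hact α g w⟩
      | mul x y ihx ihy =>
        intro w hw
        obtain ⟨w₁, h₁, e₁⟩ := ihy w hw
        obtain ⟨w₂, h₂, e₂⟩ := ihx w₁ h₁
        exact ⟨w₂, h₂, by rw [e₂, e₁, QuotientGroup.mk_mul, mul_assoc]⟩
    obtain ⟨w, hw, e⟩ := key x [] trivial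
    exact ⟨w, hw, by rw [e, toGroup_nil, mul_one]⟩

end GraphProd

theorem mainTheorem7 {L : Type*} [Finite L] (I : SimpleGraph L) (G : L → Type*)
    [∀ α, Group (G α)] [∀ α, Nontrivial (G α)] [∀ α, Group.FG (G α)]
    (x y : GraphProd.Word G)
    (hx : GraphProd.IsCyclicallyReduced I x) (hy : GraphProd.IsCyclicallyReduced I y)
    (hxc : GraphProd.IsConnected I x) (hyc : GraphProd.IsConnected I y)
    (hal : GraphProd.al x = GraphProd.al y) (hcard : 2 ≤ (GraphProd.al x).ncard) :
    IsConj (GraphProd.Word.toGroup I x) (GraphProd.Word.toGroup I y) ↔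
      GraphProd.TranspositionEquiv I x y := by
  refine ⟨fun h => ?_, GraphProd.TranspositionEquiv.isConj⟩
  -- Symmetry gives `c y c⁻¹ = x`, the orientation `c y = x c` that the descent uses.
  obtain ⟨c, hc⟩ := isConj_iff.1 h.symm
  obtain ⟨w, hw, rfl⟩ := GraphProd.exists_red_toGroup c
  exact GraphProd.transpositionEquiv_of_conj _ x y w rfl (hx.cycRed hxc hcard)
    (hy.cycRed hyc (hal ▸ hcard)) hw (mul_inv_eq_iff_eq_mul.1 hc)
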